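/- Let $n,p\ge 1$, let $\Omega\subset\mathbb{R}^n\times\mathbb{R}^p$ be open, let $f:\Omega\to\mathbb{R}^n$ be of class $C^1$, and let $t_0<t_1$. A $C^1$ trajectory of the control system $x'=f(x,u)$ on $[t_0,t_1]$ is a pair $(x,u)$ of $C^1$ functions $x:[t_0,t_1]\to\mathbb{R}^n$, $u:[t_0,t_1]\to\mathbb{R}^p$ such that $(x(t),u(t))\in\Omega$ and $x'(t)=f(x(t),u(t))$ for all $t\in[t_0,t_1]$. Let $(\bar x,\bar u)$ be a $C^1$ trajectory on $[t_0,t_1]$ and put $A(t)=\partial_x f(\bar x(t),\bar u(t))$, $B(t)=\partial_u f(\bar x(t),\bar u(t))$. Assume that the linearized system $x'(t)=A(t)x(t)+B(t)u(t)$ is controllable for the time interval $[t_0,t_1]$, i.e., for all $x_0,x_1\in\mathbb{R}^n$ there is $u\in L^2((t_0,t_1),\mathbb{R}^p)$ such that the solution $x\in C([t_0,t_1],\mathbb{R}^n)$ of $$x(t)=x_0+\int_{t_0}^t A(s)x(s)\,ds+\int_{t_0}^t B(s)u(s)\,ds,\qquad t\in[t_0,t_1],$$ satisfies $x(t_1)=x_1$.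 Then $x'=f(x,u)$ is locally controllable along $(\bar x,\bar u)$: for every $\varepsilon>0$ there is $\delta>0$ such that for all $x_0\in B(\bar x(t_0),\delta)$ and $x_1\in B(\bar x(t_1),\delta)$ there is a $C^1$ trajectory $(x,u)$ of $x'=f(x,u)$ on $[t_0,t_1]$ with $$\|u-\bar u\|_{C^1([t_0,t_1])}\le\varepsilon,\qquad x(t_0)=x_0,\qquad x(t_1)=x_1,$$ where $\|g\|_{C^1([t_0,t_1])}=\sup_{[t_0,t_1]}\|g\|+\sup_{[t_0,t_1]}\|g'\|$. -/

import Mathlib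

open Set MeasureTheory

noncomputable section

/-- `(x, u)` is a `C¹` trajectory on `[t₀, t₁]` of the control system `x' = f(x, u)`, where `f` is
considered on the set `Ω` of state-control pairs: `x` and `u` are of class `C¹` on the closed
interval (one-sided derivatives at the end points), `(x(t), u(t))` stays in `Ω`, and
`x'(t) = f(x(t), u(t))` for all `t ∈ [t₀, t₁]`. Values outside `[t₀, t₁]` play no role. -/
structure IsC1Trajectory {n p : ℕ}
    (Ω : Set (EuclideanSpace ℝ (Fin n) × EuclideanSpace ℝ (Fin p)))
    (f : EuclideanSpace ℝ (Fin n) × EuclideanSpace ℝ (Fin p) → EuclideanSpace ℝ (Fin n))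
    (t₀ t₁ : ℝ) (x : ℝ → EuclideanSpace ℝ (Fin n)) (u : ℝ → EuclideanSpace ℝ (Fin p)) :
    Prop where
  contDiffOn_state : ContDiffOn ℝ 1 x (Icc t₀ t₁)
  contDiffOn_control : ContDiffOn ℝ 1 u (Icc t₀ t₁)
  mem_domain : ∀ t ∈ Icc t₀ t₁, (x t, u t) ∈ Ω
  hasDerivWithinAt : ∀ t ∈ Icc t₀ t₁, HasDerivWithinAt x (f (x t, u t)) (Icc t₀ t₁) t

/-- The norm of `C¹([t₀, t₁])`: `sup ‖g‖ + sup ‖g'‖` over `[t₀, t₁]`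
(meant for functions of class `C¹` on `[t₀, t₁]`, for which both suprema are finite). -/
def c1Norm {p : ℕ} (t₀ t₁ : ℝ) (g : ℝ → EuclideanSpace ℝ (Fin p)) : ℝ :=
  (⨆ t : Icc t₀ t₁, ‖g t‖) + ⨆ t : Icc t₀ t₁, ‖derivWithin g (Icc t₀ t₁) t‖

/-- Local controllability of `x' = f(x, u)` along `(xbar, ubar)` on `[t₀, t₁]`. -/
def LocallyControllableAlong {n p : ℕ}
    (Ω : Set (EuclideanSpace ℝ (Fin n) × EuclideanSpace ℝ (Fin p)))
    (f : EuclideanSpace ℝ (Fin n) × EuclideanSpace ℝ (Fin p) → EuclideanSpace ℝ (Fin n))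
    (t₀ t₁ : ℝ) (xbar : ℝ → EuclideanSpace ℝ (Fin n)) (ubar : ℝ → EuclideanSpace ℝ (Fin p)) :
    Prop :=
  ∀ ε : ℝ, 0 < ε → ∃ δ : ℝ, 0 < δ ∧
    ∀ x₀ ∈ Metric.ball (xbar t₀) δ, ∀ x₁ ∈ Metric.ball (xbar t₁) δ,
      ∃ (x : ℝ → EuclideanSpace ℝ (Fin n)) (u : ℝ → EuclideanSpace ℝ (Fin p)),
        IsC1Trajectory Ω f t₀ t₁ x u ∧
        c1Norm t₀ t₁ (fun t => u t - ubar t) ≤ ε ∧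
        x t₀ = x₀ ∧ x t₁ = x₁

/-- `x` is the (continuous, integral-sense) solution on `[t₀, t₁]` of
`x'(t) = A(t) x(t) + B(t) u(t)`, `x(t₀) = x₀`. -/
def IsLinearSolution {n p : ℕ} (t₀ t₁ : ℝ)
    (A : ℝ → EuclideanSpace ℝ (Fin n) →L[ℝ] EuclideanSpace ℝ (Fin n))
    (B : ℝ → EuclideanSpace ℝ (Fin p) →L[ℝ] EuclideanSpace ℝ (Fin n))
    (u : ℝ → EuclideanSpace ℝ (Fin p)) (x₀ : EuclideanSpace ℝ (Fin n))
    (x : ℝ → EuclideanSpace ℝ (Fin n)) : Prop :=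
  ContinuousOn x (Icc t₀ t₁) ∧
    ∀ t ∈ Icc t₀ t₁, x t = x₀ + (∫ s in t₀..t, A s (x s)) + ∫ s in t₀..t, B s (u s)

/-- Controllability of `x'(t) = A(t) x(t) + B(t) u(t)` for the time interval `[t₀, t₁]`, with
controls in `L²((t₀, t₁), ℝᵖ)`. -/
def LinearControllable {n p : ℕ} (t₀ t₁ : ℝ)
    (A : ℝ → EuclideanSpace ℝ (Fin n) →L[ℝ] EuclideanSpace ℝ (Fin n))
    (B : ℝ → EuclideanSpace ℝ (Fin p) →L[ℝ] EuclideanSpace ℝ (Fin n)) : Prop :=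
  ∀ x₀ x₁ : EuclideanSpace ℝ (Fin n),
    ∃ u : ℝ → EuclideanSpace ℝ (Fin p), MemLp u 2 (volume.restrict (Ioo t₀ t₁)) ∧
      ∃ x : ℝ → EuclideanSpace ℝ (Fin n), IsLinearSolution t₀ t₁ A B u x₀ x ∧ x t₁ = x₁

/-- `A(t) = ∂f/∂x (xbar(t), ubar(t))`. -/
def linearizedState {n p : ℕ}
    (f : EuclideanSpace ℝ (Fin n) × EuclideanSpace ℝ (Fin p) → EuclideanSpace ℝ (Fin n))
    (xbar : ℝ → EuclideanSpace ℝ (Fin n)) (ubar : ℝ → EuclideanSpace ℝ (Fin p)) (t : ℝ) :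
    EuclideanSpace ℝ (Fin n) →L[ℝ] EuclideanSpace ℝ (Fin n) :=
  fderiv ℝ (fun y => f (y, ubar t)) (xbar t)

/-- `B(t) = ∂f/∂u (xbar(t), ubar(t))`. -/
def linearizedControl {n p : ℕ}
    (f : EuclideanSpace ℝ (Fin n) × EuclideanSpace ℝ (Fin p) → EuclideanSpace ℝ (Fin n))
    (xbar : ℝ → EuclideanSpace ℝ (Fin n)) (ubar : ℝ → EuclideanSpace ℝ (Fin p)) (t : ℝ) :
    EuclideanSpace ℝ (Fin p) →L[ℝ] EuclideanSpace ℝ (Fin n) :=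
  fderiv ℝ (fun v => f (xbar t, v)) (ubar t)

end

/-!
Trajectories from `x₀` to `x₁` whose control is a perturbation `v` of `ubar` are the solutions of
`(y - ∫ f(y, ubar + v), y(t₁)) = (x₀, x₁)` in `C([t₀, t₁]) × ℝⁿ`. At `(xbar, 0)` the derivative of
the left-hand side in `(y, v)` is onto: `1 - ∫ A` is invertible, being a Volterra operator, and the
end point map of the linearized system is onto. The open mapping property of a map with surjective
strict derivative then yields the theorem. Smooth controls suffice for the linearized system,
because the states they reach form a subspace of `ℝⁿ`, hence a closed set, which is dense in the
states reached by integrable controls.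
-/

open Topology Filter
open scoped ContDiff SchwartzMap

noncomputable section

section Volterra

variable {E F : Type*} [NormedAddCommGroup E] [NormedSpace ℝ E]
  [NormedAddCommGroup F] [NormedSpace ℝ F] {a b : ℝ}

/-- The multiplication operator `y ↦ (t ↦ L t (y t))` of a continuous family of operators. -/
def pointwiseCLM {X : Type*} [TopologicalSpace X] [CompactSpace X] (L : C(X, F →L[ℝ] E)) :
    C(X, F) →L[ℝ] C(X, E) :=
  LinearMap.mkContinuous
    { toFun y := ⟨fun t => L t (y t), by fun_prop⟩
      map_add' y z := by ext t; simp
      map_smul' c y := by ext t; simp } ‖L‖ fun y => by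
    rw [ContinuousMap.norm_le _ (by positivity)]
    exact fun t => (L t).le_of_opNorm_le_of_le (L.norm_coe_le_norm t) (y.norm_coe_le_norm t)

@[simp]
lemma pointwiseCLM_apply {X : Type*} [TopologicalSpace X] [CompactSpace X]
    (L : C(X, F →L[ℝ] E)) (y : C(X, F)) (t : X) : pointwiseCLM L y t = L t (y t) := rfl

lemma continuous_IccExtend {Y : Type*} [TopologicalSpace Y] (h : a ≤ b) (y : C(Icc a b, Y)) :
    Continuous (IccExtend h y) :=
  y.continuous.Icc_extend'

variable [CompleteSpace E]

lemma hasDerivAt_integral_IccExtend (h : a ≤ b) (y : C(Icc a b, E)) (t : ℝ) :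
    HasDerivAt (fun t => ∫ s in a..t, IccExtend h y s) (IccExtend h y t) t :=
  ((continuous_IccExtend h y).integral_hasStrictDerivAt a t).hasDerivAt

/-- The primitive vanishing at the left end point, as an operator on `C([a, b], E)`. -/
def primitiveCLM (h : a ≤ b) : C(Icc a b, E) →L[ℝ] C(Icc a b, E) :=
  LinearMap.mkContinuous
    { toFun y := ⟨fun t => ∫ s in a..t, IccExtend h y s,
        (continuous_iff_continuousAt.2 fun t =>
          (hasDerivAt_integral_IccExtend h y t).continuousAt).comp continuous_subtype_val⟩
      map_add' y z := by
        ext t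
        exact intervalIntegral.integral_add ((continuous_IccExtend h y).intervalIntegrable _ _)
          ((continuous_IccExtend h z).intervalIntegrable _ _)
      map_smul' c y := by
        ext t
        exact intervalIntegral.integral_smul c _ } (b - a) fun y => by
    rw [ContinuousMap.norm_le _ (mul_nonneg (sub_nonneg.2 h) (norm_nonneg _))]
    intro t
    refine (intervalIntegral.norm_integral_le_of_norm_le_const
      fun s _ => y.norm_coe_le_norm (projIcc a b h s)).trans ?_
    rw [mul_comm, abs_of_nonneg (sub_nonneg.2 t.2.1)]
    gcongr
    exact t.2.2

@[simp]
lemma primitiveCLM_apply (h : a ≤ b) (y : C(Icc a b, E)) (t : Icc a b) :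
    primitiveCLM h y t = ∫ s in a..t, IccExtend h y s := rfl

lemma sub_primitiveCLM_eq_const_iff (h : a ≤ b) (y g : C(Icc a b, E)) (c : E) :
    y - primitiveCLM h g = ContinuousLinearMap.const ℝ (Icc a b) c ↔
      IccExtend h y a = c ∧ ∀ t ∈ Icc a b,
        HasDerivWithinAt (IccExtend h y) (IccExtend h g t) (Icc a b) t := by
  constructor
  · intro hy
    have heq : EqOn (IccExtend h y) (fun t => c + ∫ s in a..t, IccExtend h g s) (Icc a b) := by
      intro t ht
      rw [IccExtend_of_mem h y ht]
      exact sub_eq_iff_eq_add.1 (DFunLike.congr_fun hy ⟨t, ht⟩)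
    refine ⟨(heq (left_mem_Icc.2 h)).trans (by simp), fun t ht => ?_⟩
    exact (((hasDerivAt_integral_IccExtend h g t).const_add c).hasDerivWithinAt).congr heq
      (heq ht)
  · rintro ⟨rfl, hy⟩
    ext t
    have hsub : Icc a (t : ℝ) ⊆ Icc a b := Icc_subset_Icc_right t.2.2
    have hint : ∫ s in a..t, IccExtend h g s = IccExtend h y t - IccExtend h y a :=
      intervalIntegral.integral_eq_sub_of_hasDerivAt_of_le t.2.1
        (continuous_IccExtend h y).continuousOn
        (fun s hs => (hy s (hsub (Ioo_subset_Icc_self hs))).hasDerivAt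
          (Icc_mem_nhds hs.1 (hs.2.trans_le t.2.2)))
        ((continuous_IccExtend h g).intervalIntegrable _ _)
    simp [hint]

/-- The Volterra operator `y ↦ (t ↦ ∫ₐᵗ A y)` on `C([a, b], E)`. -/
def volterraCLM (h : a ≤ b) (A : C(Icc a b, E →L[ℝ] E)) : C(Icc a b, E) →L[ℝ] C(Icc a b, E) :=
  primitiveCLM h ∘L pointwiseCLM A

lemma norm_volterraCLM_pow_apply_le (h : a ≤ b) (A : C(Icc a b, E →L[ℝ] E)) (y : C(Icc a b, E))
    (k : ℕ) (t : Icc a b) :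
    ‖(volterraCLM h A ^ k) y t‖ ≤ (‖A‖ * (t - a)) ^ k / k.factorial * ‖y‖ := by
  induction k generalizing t with
  | zero => simpa using y.norm_coe_le_norm t
  | succ k ih =>
    rw [pow_succ', mul_apply_eq_comp]
    set z := (volterraCLM h A ^ k) y
    set C := ‖A‖ ^ (k + 1) / k.factorial * ‖y‖
    have hz : ∀ s ∈ Ioc a (t : ℝ), ‖IccExtend h (pointwiseCLM A z) s‖ ≤ C * (s - a) ^ k := by
      intro s hs
      have hs' : s ∈ Icc a b := ⟨hs.1.le, hs.2.trans t.2.2⟩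
      rw [IccExtend_of_mem h _ hs', pointwiseCLM_apply]
      refine ((A _).le_of_opNorm_le_of_le (A.norm_coe_le_norm _) (ih ⟨s, hs'⟩)).trans_eq ?_
      simp only [C, mul_pow]
      ring
    calc ‖∫ s in a..t, IccExtend h (pointwiseCLM A z) s‖
        ≤ ∫ s in a..t, C * (s - a) ^ k :=
          intervalIntegral.norm_integral_le_of_norm_le t.2.1 (.of_forall hz)
            (Continuous.intervalIntegrable (by fun_prop) _ _)
      _ = C * ((t - a) ^ (k + 1) / (k + 1)) := by
          rw [intervalIntegral.integral_const_mul,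
            intervalIntegral.integral_comp_sub_right (fun s => s ^ k), integral_pow]
          simp
      _ = (‖A‖ * (t - a)) ^ (k + 1) / (k + 1).factorial * ‖y‖ := by
          rw [mul_pow, Nat.factorial_succ]
          push_cast
          simp only [C]
          field_simp

lemma isUnit_one_sub_of_norm_pow_lt_one {R : Type*} [NormedRing R] [HasSummableGeomSeries R]
    {x : R} {k : ℕ} (hx : ‖x ^ k‖ < 1) : IsUnit (1 - x) := by
  have hcomm : Commute (1 - x) (∑ i ∈ Finset.range k, x ^ i) :=
    .sum_right _ _ _ fun i _ => ((Commute.one_left x).sub_left (.refl x)).pow_right i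
  refine (hcomm.isUnit_mul_iff.1 ?_).1
  rw [mul_neg_geom_sum]
  exact isUnit_one_sub_of_norm_lt_one hx

lemma isUnit_one_sub_volterraCLM (h : a ≤ b) (A : C(Icc a b, E →L[ℝ] E)) :
    IsUnit (1 - volterraCLM h A) := by
  obtain ⟨k, hk⟩ := ((FloorSemiring.tendsto_pow_div_factorial_atTop
    (‖A‖ * (b - a))).eventually_lt_const one_pos).exists
  have : 0 ≤ b - a := sub_nonneg.2 h
  have hpow : ‖volterraCLM h A ^ k‖ ≤ (‖A‖ * (b - a)) ^ k / k.factorial := by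
    refine ContinuousLinearMap.opNorm_le_bound _ (by positivity) fun y => ?_
    refine (ContinuousMap.norm_le _ (by positivity)).2 fun t =>
      (norm_volterraCLM_pow_apply_le h A y k t).trans ?_
    have hta : 0 ≤ (t : ℝ) - a := sub_nonneg.2 t.2.1
    gcongr
    exact t.2.2
  exact isUnit_one_sub_of_norm_pow_lt_one (x := volterraCLM h A) (hpow.trans_lt hk)

/-- The operator sending a forcing `g` to the solution `y` of `y(t) = g(t) + ∫ₐᵗ A y`. -/
def volterraSolution (h : a ≤ b) (A : C(Icc a b, E →L[ℝ] E)) :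
    C(Icc a b, E) →L[ℝ] C(Icc a b, E) :=
  Ring.inverse (1 - volterraCLM h A)

lemma volterraSolution_sub_volterraCLM (h : a ≤ b) (A : C(Icc a b, E →L[ℝ] E))
    (y : C(Icc a b, E)) : volterraSolution h A (y - volterraCLM h A y) = y :=
  DFunLike.congr_fun (Ring.inverse_mul_cancel _ (isUnit_one_sub_volterraCLM h A)) y

lemma volterraSolution_spec (h : a ≤ b) (A : C(Icc a b, E →L[ℝ] E)) (g : C(Icc a b, E)) :
    volterraSolution h A g - volterraCLM h A (volterraSolution h A g) = g :=
  DFunLike.congr_fun (Ring.mul_inverse_cancel _ (isUnit_one_sub_volterraCLM h A)) g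

end Volterra

section Superposition

variable {E G : Type*} [NormedAddCommGroup E] [NormedSpace ℝ E]
  [NormedAddCommGroup G] [NormedSpace ℝ G] {X : Type*} [TopologicalSpace X]

open Classical in
/-- The superposition (Nemytskii) operator `z ↦ f ∘ z` on continuous functions, with the junk
value `0` where `f ∘ z` is not continuous. -/
def superposition {E G : Type*} [TopologicalSpace E] [Zero E] [TopologicalSpace G]
    (f : G → E) (z : C(X, G)) : C(X, E) :=
  if h : Continuous (f ∘ z) then ⟨f ∘ z, h⟩ else 0

lemma superposition_apply {E G : Type*} [TopologicalSpace E] [Zero E] [TopologicalSpace G]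
    {Ω : Set G} {f : G → E} (hf : ContinuousOn f Ω) {z : C(X, G)}
    (hz : ∀ t, z t ∈ Ω) (t : X) : superposition f z t = f (z t) := by
  have h : Continuous (f ∘ z) := hf.comp_continuous z.continuous hz
  simp [superposition, h]

variable [CompactSpace X]

lemma eventually_forall_mem_of_isOpen {Y : Type*} [TopologicalSpace Y] {Ω : Set Y}
    (hΩ : IsOpen Ω) {z : C(X, Y)} (hz : ∀ t, z t ∈ Ω) :
    ∀ᶠ w : C(X, Y) in 𝓝 z, ∀ t, w t ∈ Ω := by
  simpa [MapsTo] using ContinuousMap.eventually_mapsTo isCompact_univ hΩ fun t _ => hz t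

lemma eventually_forall_norm_sub_sub_le {f : G → E} {z : C(X, G)} {L : C(X, G →L[ℝ] E)}
    (hfL : ∀ t, HasStrictFDerivAt f (L t) (z t)) {c : ℝ} (hc : 0 < c) :
    ∀ᶠ q : G × G in 𝓝 0, ∀ t : X,
      ‖f (z t + q.1) - f (z t + q.2) - L t (q.1 - q.2)‖ ≤ c * ‖q.1 - q.2‖ := by
  suffices H : ∀ᶠ q : G × G in 𝓝 0, ∀ t ∈ (univ : Set X),
      ‖f (z t + q.1) - f (z t + q.2) - L t (q.1 - q.2)‖ ≤ c * ‖q.1 - q.2‖ by simpa using H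
  refine isCompact_univ.eventually_forall_of_forall_eventually fun t _ => ?_
  have hshift : Tendsto (fun r : (G × G) × X => (z r.2 + r.1.1, z r.2 + r.1.2)) (𝓝 (0, t))
      (𝓝 (z t, z t)) :=
    Continuous.tendsto' (by fun_prop) _ _ (by simp)
  have hLt : ∀ᶠ r : (G × G) × X in 𝓝 (0, t), ‖L r.2 - L t‖ < c / 2 := by
    have hcont : Continuous fun r : (G × G) × X => ‖L r.2 - L t‖ := by fun_prop
    exact (hcont.tendsto (0, t)).eventually_lt_const (by simpa using half_pos hc)
  filter_upwards [hshift.eventually ((hfL t).isLittleO.def (half_pos hc)), hLt]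
    with ⟨⟨p, q⟩, s⟩ hstrict hLs
  simp only [add_sub_add_left_eq_sub] at hstrict
  calc ‖f (z s + p) - f (z s + q) - L s (p - q)‖
      = ‖(f (z s + p) - f (z s + q) - L t (p - q)) - (L s - L t) (p - q)‖ := by
        rw [sub_apply]
        congr 1
        abel
    _ ≤ c / 2 * ‖p - q‖ + c / 2 * ‖p - q‖ :=
        (norm_sub_le _ _).trans (add_le_add hstrict ((L s - L t).le_of_opNorm_le hLs.le _))
    _ = c * ‖p - q‖ := by ring

lemma hasStrictFDerivAt_superposition {Ω : Set G} (hΩ : IsOpen Ω) {f : G → E}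
    (hf : ContinuousOn f Ω) {z : C(X, G)} (hz : ∀ t, z t ∈ Ω) {L : C(X, G →L[ℝ] E)}
    (hfL : ∀ t, HasStrictFDerivAt f (L t) (z t)) :
    HasStrictFDerivAt (superposition f : C(X, G) → C(X, E)) (pointwiseCLM L) z := by
  refine .of_isLittleO (Asymptotics.IsLittleO.of_bound fun c hc => ?_)
  obtain ⟨δ, hδ, hball⟩ :=
    Metric.eventually_nhds_iff.1 (eventually_forall_norm_sub_sub_le hfL hc)
  have hnear : ∀ᶠ w : C(X, G) in 𝓝 z, (∀ t, w t ∈ Ω) ∧ dist w z < δ :=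
    (eventually_forall_mem_of_isOpen hΩ hz).and (Metric.ball_mem_nhds z hδ)
  rw [nhds_prod_eq]
  filter_upwards [hnear.prod_mk hnear] with ⟨v, w⟩ ⟨⟨hvΩ, hvz⟩, hwΩ, hwz⟩
  refine (ContinuousMap.norm_le _ (by positivity)).2 fun t => ?_
  have hdist : dist (v t - z t, w t - z t) 0 < δ := by
    rw [dist_zero_right, Prod.norm_def, max_lt_iff, ← dist_eq_norm, ← dist_eq_norm]
    exact ⟨(ContinuousMap.dist_apply_le_dist t).trans_lt hvz,
      (ContinuousMap.dist_apply_le_dist t).trans_lt hwz⟩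
  have hle := hball hdist t
  simp only [add_sub_cancel, sub_sub_sub_cancel_right] at hle
  simp only [ContinuousMap.sub_apply, superposition_apply hf hvΩ, superposition_apply hf hwΩ,
    pointwiseCLM_apply]
  exact hle.trans (mul_le_mul_of_nonneg_left ((v - w).norm_coe_le_norm t) hc.le)

end Superposition

section LinearControl

variable {E F : Type*} [NormedAddCommGroup E] [NormedSpace ℝ E]
  [NormedAddCommGroup F] [NormedSpace ℝ F] {a b : ℝ}

/-- Restriction of Schwartz functions to `[a, b]`. -/
def restrictSchwartzCLM (a b : ℝ) (F : Type*) [NormedAddCommGroup F] [NormedSpace ℝ F] :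
    𝓢(ℝ, F) →L[ℝ] C(Icc a b, F) :=
  SchwartzMap.mkCLMtoNormedSpace (fun v => ⟨fun t => v t, by fun_prop⟩)
    (fun _ _ => rfl) (fun _ _ => rfl)
    ⟨{0}, 1, zero_le_one, fun v => (ContinuousMap.norm_le _ (by positivity)).2 fun t => by
      simpa using v.norm_le_seminorm ℝ (t : ℝ)⟩

@[simp]
lemma restrictSchwartzCLM_apply (v : 𝓢(ℝ, F)) (t : Icc a b) :
    restrictSchwartzCLM a b F v t = v t := rfl

lemma exists_schwartz_integral_norm_sub_le {u : ℝ → F} {s : Set ℝ} (hu : IntegrableOn u s)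
    {ε : ℝ} (hε : 0 < ε) : ∃ v : 𝓢(ℝ, F), ∫ t in s, ‖u t - v t‖ ≤ ε := by
  obtain ⟨g, hgs, hg, hle⟩ := MemLp.exist_eLpNorm_sub_le (p := 1) ENNReal.one_ne_top le_rfl
    (memLp_one_iff_integrable.2 hu) hε
  refine ⟨hgs.toSchwartzMap hg, ?_⟩
  have hgi : IntegrableOn g s := (hg.continuous.integrable_of_hasCompactSupport hgs).integrableOn
  rw [eLpNorm_one_eq_lintegral_enorm, ← ofReal_integral_norm_eq_lintegral_enorm (hu.sub hgi),
    ENNReal.ofReal_le_ofReal_iff hε.le] at hle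
  exact hle

lemma integrableOn_IccExtend_apply (h : a ≤ b) (B : C(Icc a b, F →L[ℝ] E)) {u : ℝ → F}
    {s : Set ℝ} (hu : IntegrableOn u s) : IntegrableOn (fun t => IccExtend h B t (u t)) s := by
  refine Integrable.mono' (hu.norm.const_mul ‖B‖) ?_
    (.of_forall fun t => (B _).le_of_opNorm_le (B.norm_coe_le_norm _) _)
  exact (ContinuousLinearMap.id ℝ (F →L[ℝ] E)).aestronglyMeasurable_comp₂
    (continuous_IccExtend h B).aestronglyMeasurable hu.aestronglyMeasurable

variable [CompleteSpace E]

lemma norm_sub_primitiveCLM_pointwiseCLM_le (h : a ≤ b) (B : C(Icc a b, F →L[ℝ] E)) {u : ℝ → F}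
    (hu : IntegrableOn u (Ioc a b)) {q : C(Icc a b, E)}
    (hq : ∀ t : Icc a b, q t = ∫ s in a..t, IccExtend h B s (u s)) (w : C(Icc a b, F)) :
    ‖q - primitiveCLM h (pointwiseCLM B w)‖ ≤
      ‖B‖ * ∫ s in Ioc a b, ‖u s - IccExtend h w s‖ := by
  have hw : IntegrableOn (IccExtend h w) (Ioc a b) := (continuous_IccExtend h w).integrableOn_Ioc
  rw [← integral_const_mul]
  have hsubint : IntegrableOn (fun s => ‖B‖ * ‖u s - IccExtend h w s‖) (Ioc a b) :=
    (hu.sub hw).norm.const_mul _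
  refine (ContinuousMap.norm_le _ (by positivity)).2 fun t => ?_
  have hsub : Ioc a (t : ℝ) ⊆ Ioc a b := Ioc_subset_Ioc_right t.2.2
  calc ‖q t - ∫ s in a..t, IccExtend h B s (IccExtend h w s)‖
      = ‖∫ s in Ioc a (t : ℝ), IccExtend h B s (u s - IccExtend h w s)‖ := by
        simp only [hq, intervalIntegral.integral_of_le t.2.1, map_sub]
        rw [integral_sub ((integrableOn_IccExtend_apply h B hu).mono_set hsub)
          ((integrableOn_IccExtend_apply h B hw).mono_set hsub)]
    _ ≤ ∫ s in Ioc a (t : ℝ), ‖B‖ * ‖u s - IccExtend h w s‖ :=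
        norm_integral_le_of_norm_le (hsubint.mono_set hsub)
          (.of_forall fun s => (B _).le_of_opNorm_le (B.norm_coe_le_norm _) _)
    _ ≤ ∫ s in Ioc a b, ‖B‖ * ‖u s - IccExtend h w s‖ :=
        setIntegral_mono_set hsubint (.of_forall fun s => by positivity) hsub.eventuallyLE

lemma mem_closure_range_primitiveCLM (h : a ≤ b) (B : C(Icc a b, F →L[ℝ] E)) {u : ℝ → F}
    (hu : IntegrableOn u (Ioc a b)) {q : C(Icc a b, E)}
    (hq : ∀ t : Icc a b, q t = ∫ s in a..t, IccExtend h B s (u s)) :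
    q ∈ closure (range (primitiveCLM h ∘L pointwiseCLM B ∘L restrictSchwartzCLM a b F)) := by
  rw [Metric.mem_closure_range_iff]
  intro ε hε
  obtain ⟨η, hη, hηε⟩ := exists_pos_mul_lt hε ‖B‖
  obtain ⟨v, hv⟩ := exists_schwartz_integral_norm_sub_le hu hη
  refine ⟨v, ?_⟩
  calc dist q (primitiveCLM h (pointwiseCLM B (restrictSchwartzCLM a b F v)))
      ≤ ‖B‖ * ∫ s in Ioc a b, ‖u s - IccExtend h (restrictSchwartzCLM a b F v) s‖ := by
        rw [dist_eq_norm]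
        exact norm_sub_primitiveCLM_pointwiseCLM_le h B hu hq _
    _ = ‖B‖ * ∫ s in Ioc a b, ‖u s - v s‖ := by
        congr 1
        refine setIntegral_congr_fun measurableSet_Ioc fun s hs => ?_
        simp [IccExtend_of_mem h _ (Ioc_subset_Icc_self hs)]
    _ ≤ ‖B‖ * η := by gcongr
    _ < ε := hηε

/-- Evaluation at the right end point. -/
def endpointCLM (h : a ≤ b) : C(Icc a b, E) →L[ℝ] E :=
  ContinuousMap.evalCLM ℝ ⟨b, right_mem_Icc.2 h⟩

/-- The map sending a forcing `g` to the end point `y(b)` of the solution of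
`y(t) = g(t) + ∫ₐᵗ A y`. -/
def linearEndpointCLM (h : a ≤ b) (A : C(Icc a b, E →L[ℝ] E)) : C(Icc a b, E) →L[ℝ] E :=
  endpointCLM h ∘L volterraSolution h A

/-- The end point map `u ↦ y(b)` of the linear control system `y' = A y + B u`, `y(a) = 0`, on
continuous controls. -/
def inputToEndpointCLM (h : a ≤ b) (A : C(Icc a b, E →L[ℝ] E)) (B : C(Icc a b, F →L[ℝ] E)) :
    C(Icc a b, F) →L[ℝ] E :=
  linearEndpointCLM h A ∘L primitiveCLM h ∘L pointwiseCLM B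

/-- The state `e` is reached from `0` in the linear control system `y' = A y + B u` on `[a, b]`,
in the integral sense and by an integrable control. -/
def IsLinearlyReachable (a b : ℝ) (A : ℝ → E →L[ℝ] E) (B : ℝ → F →L[ℝ] E) (e : E) : Prop :=
  ∃ u : ℝ → F, IntegrableOn u (Ioc a b) ∧ ∃ x : ℝ → E, ContinuousOn x (Icc a b) ∧
    (∀ t ∈ Icc a b, x t = (∫ s in a..t, A s (x s)) + ∫ s in a..t, B s (u s)) ∧ x b = e

lemma IsLinearlyReachable.mem_closure_range (h : a ≤ b) {A : ℝ → E →L[ℝ] E} {B : ℝ → F →L[ℝ] E}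
    {𝒜 : C(Icc a b, E →L[ℝ] E)} (h𝒜 : ∀ t : Icc a b, A t = 𝒜 t) {ℬ : C(Icc a b, F →L[ℝ] E)}
    (hℬ : ∀ t : Icc a b, B t = ℬ t) {e : E} (he : IsLinearlyReachable a b A B e) :
    e ∈ closure (range (inputToEndpointCLM h 𝒜 ℬ ∘L restrictSchwartzCLM a b F)) := by
  obtain ⟨u, hu, x, hx, hxu, rfl⟩ := he
  let y : C(Icc a b, E) := ⟨fun t => x t, hx.domRestrict⟩
  have hsub : ∀ t : Icc a b, uIcc a (t : ℝ) ⊆ Icc a b := fun t => by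
    rw [uIcc_of_le t.2.1]
    exact Icc_subset_Icc_right t.2.2
  have hq : ∀ t : Icc a b, (y - volterraCLM h 𝒜 y) t = ∫ s in a..t, IccExtend h ℬ s (u s) := by
    intro t
    have hA : ∫ s in a..t, A s (x s) = volterraCLM h 𝒜 y t :=
      intervalIntegral.integral_congr fun s hs => by
        simp only [IccExtend_of_mem h _ (hsub t hs), h𝒜 ⟨s, hsub t hs⟩]
        rfl
    have hB : ∫ s in a..t, B s (u s) = ∫ s in a..t, IccExtend h ℬ s (u s) :=
      intervalIntegral.integral_congr fun s hs => by
        simp [IccExtend_of_mem h _ (hsub t hs), hℬ ⟨s, hsub t hs⟩]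
    rw [← hB, ContinuousMap.sub_apply, ← hA]
    exact sub_eq_of_eq_add' (hxu t t.2)
  have hend : linearEndpointCLM h 𝒜 (y - volterraCLM h 𝒜 y) = x b :=
    congrArg (endpointCLM h) (volterraSolution_sub_volterraCLM h 𝒜 y)
  rw [← hend]
  exact map_mem_closure (linearEndpointCLM h 𝒜).continuous
    (mem_closure_range_primitiveCLM h ℬ hu hq) (by rintro _ ⟨v, rfl⟩; exact ⟨v, rfl⟩)

lemma exists_inputToEndpointCLM_restrictSchwartzCLM_eq [FiniteDimensional ℝ E] (h : a ≤ b)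
    {A : ℝ → E →L[ℝ] E} {B : ℝ → F →L[ℝ] E}
    {𝒜 : C(Icc a b, E →L[ℝ] E)} (h𝒜 : ∀ t : Icc a b, A t = 𝒜 t) {ℬ : C(Icc a b, F →L[ℝ] E)}
    (hℬ : ∀ t : Icc a b, B t = ℬ t) (hreach : ∀ e, IsLinearlyReachable a b A B e) :
    ∃ σ : E →L[ℝ] 𝓢(ℝ, F),
      ∀ e, inputToEndpointCLM h 𝒜 ℬ (restrictSchwartzCLM a b F (σ e)) = e := by
  set R := inputToEndpointCLM h 𝒜 ℬ ∘L restrictSchwartzCLM a b F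
  have hclosed : IsClosed (R.range : Set E) := Submodule.closed_of_finiteDimensional _
  have hR : R.range = ⊤ := by
    refine Submodule.eq_top_iff'.2 fun e => ?_
    exact hclosed.closure_subset ((hreach e).mem_closure_range h h𝒜 hℬ)
  obtain ⟨σ, hσ⟩ := R.exists_rightInverse_of_surjective hR
  exact ⟨σ, DFunLike.congr_fun hσ⟩

end LinearControl

section Shooting

variable {E F G V : Type*} [NormedAddCommGroup E] [NormedSpace ℝ E]
  [NormedAddCommGroup F] [NormedSpace ℝ F] [NormedAddCommGroup G] [NormedSpace ℝ G]
  [NormedAddCommGroup V] [NormedSpace ℝ V] {a b : ℝ}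

/-- Pairing `(y, w) ↦ (t ↦ (y t, w t))` of a state and a control function. -/
def pairCLM {X : Type*} [TopologicalSpace X] :
    C(X, E) × C(X, F) →L[ℝ] C(X, E × F) :=
  ((ContinuousLinearMap.inl ℝ E F).compLeftContinuous ℝ X).coprod
    ((ContinuousLinearMap.inr ℝ E F).compLeftContinuous ℝ X)

@[simp]
lemma pairCLM_apply {X : Type*} [TopologicalSpace X] (w : C(X, E) × C(X, F)) (t : X) :
    pairCLM w t = (w.1 t, w.2 t) := by
  simp [pairCLM]

/-- The restriction of each `L t` to the state factor. -/
def statePart {X : Type*} [TopologicalSpace X] (L : C(X, E × F →L[ℝ] G)) : C(X, E →L[ℝ] G) :=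
  ⟨fun t => L t ∘L .inl ℝ E F, by fun_prop⟩

/-- The restriction of each `L t` to the control factor. -/
def controlPart {X : Type*} [TopologicalSpace X] (L : C(X, E × F →L[ℝ] G)) : C(X, F →L[ℝ] G) :=
  ⟨fun t => L t ∘L .inr ℝ E F, by fun_prop⟩

lemma pointwiseCLM_pairCLM {X : Type*} [TopologicalSpace X] [CompactSpace X]
    (L : C(X, E × F →L[ℝ] G)) (y : C(X, E)) (w : C(X, F)) :
    pointwiseCLM L (pairCLM (y, w)) =
      pointwiseCLM (statePart L) y + pointwiseCLM (controlPart L) w := by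
  ext t
  simp [statePart, controlPart, ← map_add]

/-- `(x, u)` is a trajectory on `[a, b]` of the control system `x' = f(x, u)` in `Ω`, with a
continuous control; values outside `[a, b]` play no role. -/
structure IsTrajectory {E F : Type*} [NormedAddCommGroup E] [NormedSpace ℝ E]
    [NormedAddCommGroup F] (Ω : Set (E × F)) (f : E × F → E) (a b : ℝ) (x : ℝ → E) (u : ℝ → F) :
    Prop where
  continuousOn_control : ContinuousOn u (Icc a b)
  mem_domain : ∀ t ∈ Icc a b, (x t, u t) ∈ Ω
  hasDerivWithinAt : ∀ t ∈ Icc a b, HasDerivWithinAt x (f (x t, u t)) (Icc a b) t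

lemma IsTrajectory.continuousOn_state {E F : Type*} [NormedAddCommGroup E] [NormedSpace ℝ E]
    [NormedAddCommGroup F] {Ω : Set (E × F)} {f : E × F → E} {x : ℝ → E} {u : ℝ → F}
    (hxu : IsTrajectory Ω f a b x u) : ContinuousOn x (Icc a b) :=
  fun t ht => (hxu.hasDerivWithinAt t ht).continuousWithinAt

variable [CompleteSpace E]

lemma sub_primitiveCLM_superposition_eq_const_iff (h : a ≤ b) {Ω : Set (E × F)} {f : E × F → E}
    (hf : ContinuousOn f Ω) {x : ℝ → E} {y : C(Icc a b, E)} (hxy : ∀ t : Icc a b, x t = y t)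
    {u : ℝ → F} {w : C(Icc a b, F)} (huw : ∀ t : Icc a b, u t = w t)
    (hyw : ∀ t, (y t, w t) ∈ Ω) {c : E} :
    y - primitiveCLM h (superposition f (pairCLM (y, w))) =
        ContinuousLinearMap.const ℝ (Icc a b) c ↔
      IsTrajectory Ω f a b x u ∧ x a = c := by
  have hx : EqOn (IccExtend h y) x (Icc a b) := fun t ht =>
    (IccExtend_of_mem h y ht).trans (hxy ⟨t, ht⟩).symm
  have hfxu : ∀ t ∈ Icc a b, IccExtend h (superposition f (pairCLM (y, w))) t = f (x t, u t) := by
    intro t ht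
    rw [IccExtend_of_mem h _ ht, superposition_apply hf (by simpa using hyw), pairCLM_apply,
      hxy ⟨t, ht⟩, huw ⟨t, ht⟩]
  rw [sub_primitiveCLM_eq_const_iff, hx (left_mem_Icc.2 h), and_comm]
  refine and_congr_left' ⟨fun hy => ?_, fun hxu t ht => ?_⟩
  · exact
      { continuousOn_control := continuousOn_iff_continuous_domRestrict.2
          (w.continuous.congr fun t => (huw t).symm)
        mem_domain := fun t ht => by simpa only [hxy ⟨t, ht⟩, huw ⟨t, ht⟩] using hyw ⟨t, ht⟩
        hasDerivWithinAt := fun t ht =>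
          hfxu t ht ▸ (hy t ht).congr_of_mem hx.symm ht }
  · exact (hfxu t ht).symm ▸ (hxu.hasDerivWithinAt t ht).congr_of_mem hx ht

/-- The shooting map: for a state `y` and a perturbation `Λ v` of the control `U`, it records the
defect `y - ∫ f(y, U + Λ v)` and the end point `y(b)`. The trajectories from `x₀` to `x₁` are the
solutions of `shootingMap h f U Λ (y, v) = (x₀, x₁)`, with `x₀` read as a constant function. -/
def shootingMap (h : a ≤ b) (f : E × F → E) (U : C(Icc a b, F)) (Λ : V →L[ℝ] C(Icc a b, F))
    (w : C(Icc a b, E) × V) : C(Icc a b, E) × E :=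
  (w.1 - primitiveCLM h (superposition f (pairCLM (w.1, U + Λ w.2))), endpointCLM h w.1)

lemma shootingMap_eq_iff (h : a ≤ b) {Ω : Set (E × F)} {f : E × F → E} (hf : ContinuousOn f Ω)
    {x : ℝ → E} {y : C(Icc a b, E)} (hxy : ∀ t : Icc a b, x t = y t) {u : ℝ → F}
    {U : C(Icc a b, F)} {Λ : V →L[ℝ] C(Icc a b, F)} {v : V}
    (hu : ∀ t : Icc a b, u t = (U + Λ v) t) (hyv : ∀ t, (y t, (U + Λ v) t) ∈ Ω) {c e : E} :
    shootingMap h f U Λ (y, v) = (ContinuousLinearMap.const ℝ (Icc a b) c, e) ↔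
      IsTrajectory Ω f a b x u ∧ x a = c ∧ x b = e := by
  rw [← and_assoc, ← sub_primitiveCLM_superposition_eq_const_iff h hf hxy hu hyv,
    hxy ⟨b, right_mem_Icc.2 h⟩]
  exact Prod.ext_iff

/-- The derivative of the shooting map along a trajectory on which `f` has derivative `L`. -/
def shootingCLM (h : a ≤ b) (L : C(Icc a b, E × F →L[ℝ] E)) (Λ : V →L[ℝ] C(Icc a b, F)) :
    C(Icc a b, E) × V →L[ℝ] C(Icc a b, E) × E :=
  (.fst ℝ _ _ - primitiveCLM h ∘L pointwiseCLM L ∘L pairCLM ∘L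
    (.prod (.fst ℝ _ _) (Λ ∘L .snd ℝ _ _))).prod
    (endpointCLM h ∘L .fst ℝ _ _)

lemma hasStrictFDerivAt_shootingMap (h : a ≤ b) {Ω : Set (E × F)} (hΩ : IsOpen Ω)
    {f : E × F → E} (hf : ContinuousOn f Ω) {X : C(Icc a b, E)} {U : C(Icc a b, F)}
    (hz : ∀ t, (X t, U t) ∈ Ω) {L : C(Icc a b, E × F →L[ℝ] E)}
    (hfL : ∀ t, HasStrictFDerivAt f (L t) (X t, U t)) (Λ : V →L[ℝ] C(Icc a b, F)) :
    HasStrictFDerivAt (shootingMap h f U Λ) (shootingCLM h L Λ) (X, 0) := by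
  have hcontrol : HasStrictFDerivAt (fun w : C(Icc a b, E) × V => (w.1, U + Λ w.2))
      (.prod (.fst ℝ _ _) (Λ ∘L .snd ℝ _ _)) (X, 0) :=
    hasStrictFDerivAt_fst.prodMk ((Λ.hasStrictFDerivAt.comp _ hasStrictFDerivAt_snd).const_add U)
  have hpair := (pairCLM (E := E) (F := F)).hasStrictFDerivAt.comp (X, (0 : V)) hcontrol
  have hsup : HasStrictFDerivAt (superposition f : C(Icc a b, E × F) → C(Icc a b, E))
      (pointwiseCLM L) (pairCLM (X, U + Λ 0)) :=
    hasStrictFDerivAt_superposition hΩ hf (by simpa using hz) (by simpa using hfL)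
  have hintegral := (primitiveCLM h).hasStrictFDerivAt.comp (X, (0 : V)) (hsup.comp (X, 0) hpair)
  exact (hasStrictFDerivAt_fst.sub hintegral).prodMk
    ((endpointCLM (E := E) h).hasStrictFDerivAt.comp (X, (0 : V)) hasStrictFDerivAt_fst)

lemma range_shootingCLM_eq_top (h : a ≤ b) {L : C(Icc a b, E × F →L[ℝ] E)}
    {Λ : V →L[ℝ] C(Icc a b, F)}
    (hΛ : ∀ e, ∃ v, inputToEndpointCLM h (statePart L) (controlPart L) (Λ v) = e) :
    (shootingCLM h L Λ).range = ⊤ := by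
  refine LinearMap.range_eq_top.2 fun ⟨g, e⟩ => ?_
  set A := statePart L
  set B := controlPart L
  obtain ⟨v, hv⟩ := hΛ (e - linearEndpointCLM h A g)
  set y := volterraSolution h A (g + primitiveCLM h (pointwiseCLM B (Λ v)))
  have hy : y - primitiveCLM h (pointwiseCLM L (pairCLM (y, Λ v))) = g := by
    rw [pointwiseCLM_pairCLM, map_add, ← sub_sub, sub_eq_iff_eq_add]
    exact volterraSolution_spec h A _
  have hyb : endpointCLM h y = e := by
    change linearEndpointCLM h A (g + primitiveCLM h (pointwiseCLM B (Λ v))) = e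
    rw [map_add]
    exact add_eq_of_eq_sub' hv
  exact ⟨(y, v), Prod.ext hy hyb⟩

lemma eventually_exists_shootingMap_eq [CompleteSpace V] (h : a ≤ b) {Ω : Set (E × F)}
    (hΩ : IsOpen Ω) {f : E × F → E} (hf : ContinuousOn f Ω) {X : C(Icc a b, E)}
    {U : C(Icc a b, F)} (hz : ∀ t, (X t, U t) ∈ Ω) {L : C(Icc a b, E × F →L[ℝ] E)}
    (hfL : ∀ t, HasStrictFDerivAt f (L t) (X t, U t)) {Λ : V →L[ℝ] C(Icc a b, F)}
    (hΛ : ∀ e, ∃ v, inputToEndpointCLM h (statePart L) (controlPart L) (Λ v) = e)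
    {N : Set (C(Icc a b, E) × V)} (hN : N ∈ 𝓝 (X, 0)) :
    ∀ᶠ q in 𝓝 (shootingMap h f U Λ (X, 0)), ∃ w ∈ N, shootingMap h f U Λ w = q := by
  rw [← (hasStrictFDerivAt_shootingMap h hΩ hf hz hfL Λ).map_nhds_eq_of_surj
    (range_shootingCLM_eq_top h hΛ)]
  exact image_mem_map hN

end Shooting

/-- Local controllability of `x' = f(x, u)` along `(xbar, ubar)` with perturbations `u - ubar` that
are restrictions of arbitrarily small Schwartz functions; these are small in every `Cᵐ` norm. -/
def SmoothlyControllableAlong {E F : Type*} [NormedAddCommGroup E] [NormedSpace ℝ E]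
    [NormedAddCommGroup F] [NormedSpace ℝ F] (Ω : Set (E × F)) (f : E × F → E) (a b : ℝ)
    (xbar : ℝ → E) (ubar : ℝ → F) : Prop :=
  ∀ N ∈ 𝓝 (0 : 𝓢(ℝ, F)), ∀ᶠ q : E × E in 𝓝 (xbar a, xbar b), ∃ x : ℝ → E, ∃ v ∈ N,
    IsTrajectory Ω f a b x (fun t => ubar t + v t) ∧ x a = q.1 ∧ x b = q.2

lemma smoothlyControllableAlong_of_surjective {E F V : Type*}
    [NormedAddCommGroup E] [NormedSpace ℝ E] [CompleteSpace E]
    [NormedAddCommGroup F] [NormedSpace ℝ F]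
    [NormedAddCommGroup V] [NormedSpace ℝ V] [CompleteSpace V] {a b : ℝ} (h : a ≤ b)
    {Ω : Set (E × F)} (hΩ : IsOpen Ω) {f : E × F → E} (hf : ContinuousOn f Ω)
    {xbar : ℝ → E} {ubar : ℝ → F} (htraj : IsTrajectory Ω f a b xbar ubar)
    {X : C(Icc a b, E)} (hX : ∀ t : Icc a b, xbar t = X t)
    {U : C(Icc a b, F)} (hU : ∀ t : Icc a b, ubar t = U t)
    {L : C(Icc a b, E × F →L[ℝ] E)} (hfL : ∀ t, HasStrictFDerivAt f (L t) (X t, U t))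
    (σ : V →L[ℝ] 𝓢(ℝ, F)) (hσ : ∀ e, ∃ v,
      inputToEndpointCLM h (statePart L) (controlPart L) (restrictSchwartzCLM a b F (σ v)) = e) :
    SmoothlyControllableAlong Ω f a b xbar ubar := by
  intro N hN
  have hz : ∀ t, (X t, U t) ∈ Ω := fun t => hX t ▸ hU t ▸ htraj.mem_domain t t.2
  set Λ : V →L[ℝ] C(Icc a b, F) := restrictSchwartzCLM a b F ∘L σ
  have hshoot : shootingMap h f U Λ (X, 0) =
      (ContinuousLinearMap.const ℝ (Icc a b) (xbar a), xbar b) :=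
    (shootingMap_eq_iff h hf hX (by simpa using hU) (by simpa using hz)).2 ⟨htraj, rfl, rfl⟩
  have htarget : Tendsto (fun q : E × E => (ContinuousLinearMap.const ℝ (Icc a b) q.1, q.2))
      (𝓝 (xbar a, xbar b)) (𝓝 (shootingMap h f U Λ (X, 0))) :=
    Continuous.tendsto' (by fun_prop) _ _ hshoot.symm
  have hnear : {w : C(Icc a b, E) × V | σ w.2 ∈ N ∧ ∀ t, (w.1 t, (U + Λ w.2) t) ∈ Ω} ∈
      𝓝 (X, 0) := by
    have hσN : Tendsto (fun w : C(Icc a b, E) × V => σ w.2) (𝓝 (X, 0)) (𝓝 0) :=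
      Continuous.tendsto' (by fun_prop) _ _ (map_zero σ)
    have hpair : Tendsto (fun w : C(Icc a b, E) × V => pairCLM (w.1, U + Λ w.2)) (𝓝 (X, 0))
        (𝓝 (pairCLM (X, U))) :=
      Continuous.tendsto' (by fun_prop) _ _ (by simp)
    have hΩX := hpair.eventually (eventually_forall_mem_of_isOpen hΩ (by simpa using hz))
    filter_upwards [hσN hN, hΩX] with w hwN hwΩ using ⟨hwN, by simpa using hwΩ⟩
  have hopen := eventually_exists_shootingMap_eq h hΩ hf hz hfL hσ (Λ := Λ) hnear
  filter_upwards [htarget.eventually hopen] with q ⟨⟨y, v⟩, ⟨hvN, hyΩ⟩, hq⟩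
  exact ⟨IccExtend h y, σ v, hvN, (shootingMap_eq_iff h hf (IccExtend_val h y)
    (fun t => congrArg (· + σ v t) (hU t)) hyΩ).1 hq⟩

theorem theorem8p1_general {E F : Type*} [NormedAddCommGroup E] [NormedSpace ℝ E]
    [FiniteDimensional ℝ E] [NormedAddCommGroup F] [NormedSpace ℝ F] {Ω : Set (E × F)}
    (hΩ : IsOpen Ω) {f : E × F → E} (hf : ContDiffOn ℝ 1 f Ω) {a b : ℝ} (h : a ≤ b)
    {xbar : ℝ → E} {ubar : ℝ → F} (htraj : IsTrajectory Ω f a b xbar ubar)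
    (hreach : ∀ e, IsLinearlyReachable a b (fun t => fderiv ℝ (fun y => f (y, ubar t)) (xbar t))
      (fun t => fderiv ℝ (fun v => f (xbar t, v)) (ubar t)) e) :
    SmoothlyControllableAlong Ω f a b xbar ubar := by
  have := FiniteDimensional.complete ℝ E
  let X : C(Icc a b, E) := ⟨fun t => xbar t, htraj.continuousOn_state.domRestrict⟩
  let U : C(Icc a b, F) := ⟨fun t => ubar t, htraj.continuousOn_control.domRestrict⟩
  have hz : ∀ t, (X t, U t) ∈ Ω := fun t => htraj.mem_domain t t.2
  let L : C(Icc a b, E × F →L[ℝ] E) := ⟨fun t => fderiv ℝ f (X t, U t),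
    (hf.continuousOn_fderiv_of_isOpen hΩ le_rfl).comp_continuous (by fun_prop) hz⟩
  have hfL : ∀ t, HasStrictFDerivAt f (L t) (X t, U t) := fun t =>
    (hf.contDiffAt (hΩ.mem_nhds (hz t))).hasStrictFDerivAt one_ne_zero
  obtain ⟨σ, hσ⟩ := exists_inputToEndpointCLM_restrictSchwartzCLM_eq h (𝒜 := statePart L)
    (fun t => ((hfL t).hasFDerivAt.comp (X t) (hasFDerivAt_prodMk_left (X t) (U t))).fderiv)
    (ℬ := controlPart L)
    (fun t => ((hfL t).hasFDerivAt.comp (U t) (hasFDerivAt_prodMk_right (X t) (U t))).fderiv)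
    hreach
  exact smoothlyControllableAlong_of_surjective h hΩ hf.continuousOn htraj (fun _ => rfl)
    (fun _ => rfl) hfL σ fun e => ⟨e, hσ e⟩

section EuclideanSpace

variable {n p : ℕ} {Ω : Set (EuclideanSpace ℝ (Fin n) × EuclideanSpace ℝ (Fin p))}
  {f : EuclideanSpace ℝ (Fin n) × EuclideanSpace ℝ (Fin p) → EuclideanSpace ℝ (Fin n)}
  {t₀ t₁ : ℝ} {x : ℝ → EuclideanSpace ℝ (Fin n)} {u : ℝ → EuclideanSpace ℝ (Fin p)}

lemma IsC1Trajectory.isTrajectory (hxu : IsC1Trajectory Ω f t₀ t₁ x u) :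
    IsTrajectory Ω f t₀ t₁ x u :=
  ⟨hxu.contDiffOn_control.continuousOn, hxu.mem_domain, hxu.hasDerivWithinAt⟩

lemma IsTrajectory.isC1Trajectory (h : t₀ < t₁) (hf : ContinuousOn f Ω)
    (hxu : IsTrajectory Ω f t₀ t₁ x u) (hu : ContDiffOn ℝ 1 u (Icc t₀ t₁)) :
    IsC1Trajectory Ω f t₀ t₁ x u where
  contDiffOn_state := by
    have hx' : EqOn (derivWithin x (Icc t₀ t₁)) (fun t => f (x t, u t)) (Icc t₀ t₁) := fun t ht =>
      (hxu.hasDerivWithinAt t ht).derivWithin (uniqueDiffOn_Icc h t ht)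
    refine (contDiffOn_one_iff_derivWithin (uniqueDiffOn_Icc h)).2
      ⟨fun t ht => (hxu.hasDerivWithinAt t ht).differentiableWithinAt, ?_⟩
    exact (hf.comp (hxu.continuousOn_state.prodMk hu.continuousOn) hxu.mem_domain).congr hx'
  contDiffOn_control := hu
  mem_domain := hxu.mem_domain
  hasDerivWithinAt := hxu.hasDerivWithinAt

lemma LinearControllable.isLinearlyReachable
    {A : ℝ → EuclideanSpace ℝ (Fin n) →L[ℝ] EuclideanSpace ℝ (Fin n)}
    {B : ℝ → EuclideanSpace ℝ (Fin p) →L[ℝ] EuclideanSpace ℝ (Fin n)}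
    (hAB : LinearControllable t₀ t₁ A B) (e : EuclideanSpace ℝ (Fin n)) :
    IsLinearlyReachable t₀ t₁ A B e := by
  obtain ⟨u, hu, x, ⟨hx, hxu⟩, hxe⟩ := hAB 0 e
  refine ⟨u, ?_, x, hx, fun t ht => by simpa using hxu t ht, hxe⟩
  exact integrableOn_Ioc_iff_integrableOn_Ioo (by simp) |>.2 (hu.integrable one_le_two)

lemma c1Norm_schwartz_le (h : t₀ < t₁) (v : 𝓢(ℝ, EuclideanSpace ℝ (Fin p))) :
    c1Norm t₀ t₁ v ≤ SchwartzMap.seminorm ℝ 0 0 v + SchwartzMap.seminorm ℝ 0 1 v := by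
  have : Nonempty (Icc t₀ t₁) := ⟨⟨t₀, left_mem_Icc.2 h.le⟩⟩
  refine add_le_add (ciSup_le fun t => v.norm_le_seminorm ℝ _) (ciSup_le fun t => ?_)
  rw [v.differentiableAt.derivWithin (uniqueDiffOn_Icc h t t.2)]
  simpa using v.le_seminorm' ℝ 0 1 t

lemma SmoothlyControllableAlong.locallyControllableAlong (h : t₀ < t₁) (hf : ContinuousOn f Ω)
    (hu : ContDiffOn ℝ 1 u (Icc t₀ t₁)) (hxu : SmoothlyControllableAlong Ω f t₀ t₁ x u) :
    LocallyControllableAlong Ω f t₀ t₁ x u := by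
  intro ε hε
  have hN : ∀ᶠ v : 𝓢(ℝ, EuclideanSpace ℝ (Fin p)) in 𝓝 0,
      SchwartzMap.seminorm ℝ 0 0 v + SchwartzMap.seminorm ℝ 0 1 v < ε := by
    have hcont := (schwartz_withSeminorms ℝ ℝ (EuclideanSpace ℝ (Fin p))).continuous_seminorm
    exact ((hcont (0, 0)).add (hcont (0, 1))).tendsto' 0 0 (by simp) |>.eventually_lt_const hε
  obtain ⟨δ, hδ, hball⟩ := Metric.eventually_nhds_iff_ball.1 (hxu _ hN)
  refine ⟨δ, hδ, fun x₀ hx₀ x₁ hx₁ => ?_⟩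
  obtain ⟨y, v, hv, hy, hy₀, hy₁⟩ := hball (x₀, x₁) (by
    rw [← ball_prod_same]
    exact ⟨hx₀, hx₁⟩)
  refine ⟨y, fun t => u t + v t, hy.isC1Trajectory h hf (hu.add (v.smooth 1).contDiffOn), ?_,
    hy₀, hy₁⟩
  simp only [add_sub_cancel_left]
  exact (c1Norm_schwartz_le h v).trans hv.le

end EuclideanSpace

end

theorem theorem8p1 {n p : ℕ}
    (Ω : Set (EuclideanSpace ℝ (Fin n) × EuclideanSpace ℝ (Fin p))) (hΩ : IsOpen Ω)
    (f : EuclideanSpace ℝ (Fin n) × EuclideanSpace ℝ (Fin p) → EuclideanSpace ℝ (Fin n))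
    (hf : ContDiffOn ℝ 1 f Ω)
    (t₀ t₁ : ℝ) (ht : t₀ < t₁)
    (xbar : ℝ → EuclideanSpace ℝ (Fin n)) (ubar : ℝ → EuclideanSpace ℝ (Fin p))
    (htraj : IsC1Trajectory Ω f t₀ t₁ xbar ubar)
    (hlin : LinearControllable t₀ t₁ (linearizedState f xbar ubar)
      (linearizedControl f xbar ubar)) :
    LocallyControllableAlong Ω f t₀ t₁ xbar ubar :=
  (theorem8p1_general hΩ hf ht.le htraj.isTrajectory
    hlin.isLinearlyReachable).locallyControllableAlong ht hf.continuousOn htraj.contDiffOn_control
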